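/- Let $\lambda>0$ be an ordinal and let $\Omega=\langle \omega^{\omega^\lambda};\times,1,\omega,\omega+1,\omega^2+1\rangle$ be the first-order structure whose domain is the set of all ordinals below $\omega^{\omega^\lambda}$, with ordinal multiplication $\times$ as a binary function and with the four constants $1,\omega,\omega+1,\omega^2+1$. Let $E(x_1,\dots,x_p)$ be an atomic formula of $\langle\mathbb N;+,\times,0,1\rangle$, i.e. a Diophantine equation $s(x_1,\dots,x_p)=t(x_1,\dots,x_p)$ between two terms built from the variables $x_1,\dots,x_p$ by means of $+,\times,0,1$. Then the $p$-ary relation $$\mathtt{EQ}_E=\{((\omega+1)^{j_1},\dots,(\omega+1)^{j_p}) \mid j_1,\dots,j_p\in\mathbb N,\ \langle\mathbb N;+,\times,0,1\rangle\models E(j_1,\dots,j_p)\}$$ is definable in $\Omega$ by an $\exists^*\forall^6$-formula, that is, there are an integer $m\ge 0$ and a quantifier-free formula $\psi$ in the signature of $\Omega$ (with equality, and without further parameters) such that $\mathtt{EQ}_E$ is the set of all tuples $(x_1,\dots,x_p)$ of elements of $\omega^{\omega^\lambda}$ that satisfy in $\Omega$ the formula $$\exists u_1\cdots\exists u_m\,\forall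 v_1\cdots\forall v_6\ \psi(x_1,\dots,x_p,u_1,\dots,u_m,v_1,\dots,v_6).$$ -/

import Mathlib

open scoped Ordinal

universe u

/-! ### The structure of ordinals below `ω ^ ω ^ lam` with multiplication and four constants -/

/-- The function symbols of the language with constants `1, ω, ω + 1, ω ^ 2 + 1` and a binary
multiplication. -/
inductive OrdMulFunc : ℕ → Type
  | one : OrdMulFunc 0
  | omega : OrdMulFunc 0
  | omegaAddOne : OrdMulFunc 0
  | omegaSqAddOne : OrdMulFunc 0
  | mul : OrdMulFunc 2

/-- The first-order language of `⟨ω ^ ω ^ lam; ×, 1, ω, ω + 1, ω ^ 2 + 1⟩` (no relation symbol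
besides equality). -/
def ordMulLang : FirstOrder.Language where
  Functions := OrdMulFunc
  Relations := fun _ => Empty

/-- The ordinal `ω ^ ω ^ lam`, where `lam > 0`, identified with the set of all smaller ordinals. -/
def OmegaDomain (lam : Ordinal.{u}) (_ : 0 < lam) : Type (u + 1) :=
  {a : Ordinal.{u} // a < ω ^ ω ^ lam}

namespace OmegaDomain

theorem mul_lt (lam : Ordinal.{u}) {a b : Ordinal.{u}} (ha : a < ω ^ ω ^ lam)
    (hb : b < ω ^ ω ^ lam) : a * b < ω ^ ω ^ lam :=
  Ordinal.isPrincipal_mul_omega0_opow_opow lam ha hb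

theorem omega_lt {lam : Ordinal.{u}} (h : 0 < lam) : ω < ω ^ ω ^ lam := by
  have h1 : (1 : Ordinal.{u}) < ω ^ lam :=
    (Ordinal.one_lt_omega0).trans_le (Ordinal.left_le_opow ω h)
  simpa using (Ordinal.opow_lt_opow_iff_right Ordinal.one_lt_omega0).2 h1

theorem add_one_lt {lam : Ordinal.{u}} {a : Ordinal.{u}} (ha : a < ω ^ ω ^ lam)
    (h : 0 < lam) : a + 1 < ω ^ ω ^ lam :=
  Ordinal.isPrincipal_add_omega0_opow (ω ^ lam) ha
    (Ordinal.one_lt_omega0.trans (omega_lt h))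

theorem omega_sq_lt {lam : Ordinal.{u}} (h : 0 < lam) : ω ^ 2 < ω ^ ω ^ lam := by
  rw [pow_two]
  exact mul_lt lam (omega_lt h) (omega_lt h)

variable {lam : Ordinal.{u}} {h : 0 < lam}

/-- The structure `Ω = ⟨ω ^ ω ^ lam; ×, 1, ω, ω + 1, ω ^ 2 + 1⟩`, where `×` is ordinal
multiplication (so `2 × ω = ω` and `ω × 2 = ω + ω`). -/
instance : ordMulLang.Structure (OmegaDomain lam h) where
  funMap {_} f :=
    match f with
    | OrdMulFunc.one => fun _ => ⟨1, Ordinal.one_lt_omega0.trans (omega_lt h)⟩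
    | OrdMulFunc.omega => fun _ => ⟨ω, omega_lt h⟩
    | OrdMulFunc.omegaAddOne => fun _ => ⟨ω + 1, add_one_lt (omega_lt h) h⟩
    | OrdMulFunc.omegaSqAddOne => fun _ => ⟨ω ^ 2 + 1, add_one_lt (omega_sq_lt h) h⟩
    | OrdMulFunc.mul => fun x => ⟨(x 0).1 * (x 1).1, mul_lt lam (x 0).2 (x 1).2⟩
  RelMap {_} r := nomatch r

end OmegaDomain

/-! ### The structure of natural numbers with addition and multiplication -/

/-- The function symbols of the language with constants `0, 1` and binary `+, ×`. -/
inductive ArithFunc : ℕ → Type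
  | zero : ArithFunc 0
  | one : ArithFunc 0
  | add : ArithFunc 2
  | mul : ArithFunc 2

/-- The first-order language of `⟨ℕ; +, ×, 0, 1⟩` (no relation symbol besides equality). -/
def arithLang : FirstOrder.Language where
  Functions := ArithFunc
  Relations := fun _ => Empty

/-- The structure `⟨ℕ; +, ×, 0, 1⟩`. -/
instance : arithLang.Structure ℕ where
  funMap {_} f :=
    match f with
    | ArithFunc.zero => fun _ => 0
    | ArithFunc.one => fun _ => 1
    | ArithFunc.add => fun x => x 0 + x 1
    | ArithFunc.mul => fun x => x 0 * x 1
  RelMap {_} r := nomatch r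

/-! ### Syntactic fragments and definability -/

/-- Prefix a formula with a block of `k` universal quantifiers, which bind its last `k` indexed
variables. -/
def forallBlock {L : FirstOrder.Language} {α : Type} {m : ℕ} :
    (k : ℕ) → L.BoundedFormula α (m + k) → L.BoundedFormula α m
  | 0, ψ => ψ
  | k + 1, ψ => forallBlock k (FirstOrder.Language.BoundedFormula.all ψ)

/-- `φ` is an `∃*∀ᵏ`-formula: it consists of some number `m` of existential quantifiers, followed
by `k` universal quantifiers, followed by a quantifier-free formula. -/
def IsExistsForall {L : FirstOrder.Language} {α : Type} (k : ℕ) (φ : L.Formula α) : Prop :=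
  ∃ (m : ℕ) (ψ : L.BoundedFormula α (m + k)), ψ.IsQF ∧ φ = (forallBlock k ψ).exs

/-- The `p`-ary relation `R` on the `L`-structure `M` is definable, without parameters, by a
formula (with free variables indexed by `Fin p`) that belongs to the syntactic fragment `F`. -/
def FragmentDefinable {L : FirstOrder.Language} {M : Type*} [L.Structure M] {p : ℕ}
    (F : L.Formula (Fin p) → Prop) (R : Set (Fin p → M)) : Prop :=
  ∃ φ : L.Formula (Fin p), F φ ∧ R = {a | φ.Realize a}

/-- The relation `EQ_E` on `ω ^ ω ^ lam`: the set of all tuples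
`((ω + 1) ^ j₁, …, (ω + 1) ^ j_p)` with `⟨ℕ; +, ×, 0, 1⟩ ⊨ E(j₁, …, j_p)`. -/
def eqRel (lam : Ordinal.{u}) (h : 0 < lam) {p : ℕ} (E : arithLang.Formula (Fin p)) :
    Set (Fin p → OmegaDomain lam h) :=
  {a | ∃ j : Fin p → ℕ, E.Realize j ∧ ∀ i, (a i).1 = (ω + 1) ^ j i}

/-!
A number `j` is represented by `(ω + 1) ^ j`, so that addition of exponents is multiplication of
ordinals. Besides `0`, the ordinals that commute with `ω + 1` are exactly its powers
(`Ordinal.commute_omega0_add_one_iff`), hence the set of representatives is quantifier-free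
definable. It remains to define multiplication of exponents, for which squaring suffices
(`OmegaDomain.eaDefinable_mul`).

Let the degree of `x ≠ 0` be the exponent of the leading term of its Cantor normal form. Degrees
are compared by means of `x * ω = ω ^ (deg x + 1)`; in particular `(ω + 1) ^ j` has degree `j`.
Suppose that `c = ω * q + 1` has finite degree `n > 0`, and that `x` commutes with `c` and has
finite degree at least `n`. Then `c` divides `x * ω`, so `x * c = x * ω * q + x` and `c * x` show
that the remainder of `x` modulo `c` is zero, and `x = c * y` where `y` again commutes with `c`
(`Ordinal.exists_eq_mul_of_commute`). By descent, if `1` is the only ordinal of degree less than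
`n` that commutes with `c`, then every ordinal of finite degree that commutes with `c` has a degree
divisible by `n` (`Ordinal.IsPrimitive.dvd_of_commute`). These properties of `c` are expressed with
universal quantifiers in `Ordinal.IsPrimitive`, and `ω ^ n + 1` has them
(`Ordinal.isPrimitive_omega0_pow_add_one`).

Given such `c` and `d` of degrees `i + 1` and `i + 2`, the least positive degree shared by an
ordinal commuting with `c` and one commuting with `d` is the least common multiple
`(i + 1) * (i + 2) = i ^ 2 + 3 * i + 2`, attained at `c ^ (i + 2)` and `d ^ (i + 1)`. This defines
`i ^ 2` from `i` (`Ordinal.exists_isLeastCommuting_iff`). All universal conditions involve at most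
three variables, and a conjunction of `∃*∀⁶`-formulas is again one, since the universal quantifiers
can be shared; so the graph of every term is definable, by induction on the term
(`OmegaDomain.eaDefinable_term`).
-/

/-! ### Degrees and left division of ordinals -/

namespace Ordinal

theorem mul_omega0_eq_opow {x : Ordinal.{u}} (hx : x ≠ 0) : x * ω = ω ^ (log ω x + 1) := by
  simpa using mul_eq_opow_log_succ hx isPrincipal_mul_omega0 (natCast_lt_omega0 2)

theorem mul_omega0_eq_self_iff {x : Ordinal.{u}} : x * ω = x ↔ x = 0 := by
  refine ⟨fun h => ?_, fun h => by simp [h]⟩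
  by_contra hx
  have : x * 1 < x * ω := mul_lt_mul_of_pos_left one_lt_omega0 (pos_iff_ne_zero.2 hx)
  rw [mul_one, h] at this
  exact this.false

theorem lt_of_mul_omega0 {x : Ordinal.{u}} {n : ℕ} (h : x * ω = ω ^ n) : x < ω ^ n := by
  have hx : x ≠ 0 := by
    rintro rfl
    rw [zero_mul] at h
    exact pow_ne_zero n omega0_ne_zero h.symm
  calc x = x * 1 := (mul_one x).symm
    _ < x * ω := mul_lt_mul_of_pos_left one_lt_omega0 (pos_iff_ne_zero.2 hx)
    _ = ω ^ n := h

theorem pow_omega0_inj {m n : ℕ} (h : (ω : Ordinal.{u}) ^ m = ω ^ n) : m = n := by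
  rw [← opow_natCast, ← opow_natCast, opow_right_inj one_lt_omega0] at h
  exact_mod_cast h

/-- A nonzero ordinal below a finite power of `ω` has a finite degree. -/
theorem exists_mul_omega0_eq_pow {x : Ordinal.{u}} (hx : x ≠ 0) {n : ℕ} (h : x < ω ^ n) :
    ∃ k : ℕ, k < n ∧ x * ω = ω ^ (k + 1) := by
  have h1 : log ω x < n := by
    rw [← lt_opow_iff_log_lt one_lt_omega0 hx, opow_natCast]; exact h
  obtain ⟨k, hk⟩ := lt_omega0.1 (h1.trans (natCast_lt_omega0 n))
  refine ⟨k, by rw [hk] at h1; exact_mod_cast h1, ?_⟩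
  rw [mul_omega0_eq_opow hx, hk, ← opow_natCast]; norm_cast

theorem pow_mul_omega0 {c : Ordinal.{u}} {n : ℕ} (hc : c * ω = ω ^ (n + 1)) (k : ℕ) :
    c ^ k * ω = ω ^ (n * k + 1) := by
  induction k with
  | zero => simp
  | succ k ih =>
    rw [pow_succ, mul_assoc, hc, add_comm n 1, pow_add ω 1 n, pow_one, ← mul_assoc, ih, ← pow_add]
    congr 1; ring

theorem mul_mul_omega0 {x y : Ordinal.{u}} {m n : ℕ} (hx : x * ω = ω ^ (m + 1))
    (hy : y * ω = ω ^ (n + 1)) : x * y * ω = ω ^ (m + n + 1) := by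
  rw [mul_assoc, hy, pow_succ', ← mul_assoc, hx, ← pow_add]
  congr 1; ring

theorem omega0_add_one_mul_omega0 : ((ω : Ordinal.{u}) + 1) * ω = ω ^ 2 := by
  rw [add_mul_of_isSuccLimit one_add_omega0 isSuccLimit_omega0, pow_two]

theorem omega0_add_one_pow_mul_omega0 (j : ℕ) : ((ω : Ordinal.{u}) + 1) ^ j * ω = ω ^ (j + 1) := by
  rw [pow_mul_omega0 (n := 1) omega0_add_one_mul_omega0, one_mul]

theorem omega0_add_one_pow_inj {i j : ℕ} (h : ((ω : Ordinal.{u}) + 1) ^ i = (ω + 1) ^ j) :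
    i = j := by
  have h' := congrArg (· * ω) h
  simp only [omega0_add_one_pow_mul_omega0] at h'
  exact Nat.succ_injective (pow_omega0_inj h')

/-- The remainder of `x` modulo `c = ω * q + 1` vanishes if `x` commutes with `c` and `c` divides
`x * ω`: indeed `x * c = x * ω * q + x` has the remainder of `x`, and `c * x` has remainder `0`. -/
theorem exists_eq_mul_of_commute {c q x z : Ordinal.{u}} (hc : c = ω * q + 1)
    (hz : x * ω = c * z) (h : x * c = c * x) : ∃ y, x = c * y ∧ y * c = c * y := by
  have hc0 : c ≠ 0 := by rw [hc]; simp
  have hx : x % c = 0 := by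
    have h1 : x * c = c * (z * q) + x := by
      conv_lhs => rw [hc, mul_add, mul_one, ← mul_assoc, hz, mul_assoc]
    rw [h] at h1
    have h2 := congrArg (· % c) h1
    simp only [mul_mod, mul_add_mod_self] at h2
    exact h2.symm
  obtain ⟨y, rfl⟩ := dvd_of_mod_eq_zero hx
  refine ⟨y, rfl, ?_⟩
  rw [mul_assoc] at h
  exact mul_left_cancel₀ hc0 h

/-! ### Powers of `ω + 1` -/

theorem eq_one_of_commute_of_lt_omega0 {x : Ordinal.{u}} (hx0 : x ≠ 0) (hx : x < ω)
    (h : x * (ω + 1) = (ω + 1) * x) : x = 1 := by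
  obtain ⟨n, rfl⟩ := lt_omega0.1 hx
  have hn : 0 < n := Nat.pos_of_ne_zero (by rintro rfl; simp at hx0)
  obtain ⟨m, rfl⟩ : ∃ m, n = m + 1 := ⟨n - 1, by omega⟩
  rw [mul_add, mul_one, natCast_mul_omega0 hn, Nat.cast_add_one, add_mul_add_one _ one_add_omega0,
    mul_add, mul_one, add_assoc] at h
  have h2 := congrArg (· % ω) h
  simp only [mul_add_mod_self] at h2
  have h3 : (ω + (m + 1) : Ordinal.{u}) % ω = (m + 1) % ω := by
    simpa using mul_add_mod_self (ω : Ordinal.{u}) 1 (m + 1)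
  have h4 : (ω + 1 : Ordinal.{u}) % ω = 1 % ω := by
    simpa using mul_add_mod_self (ω : Ordinal.{u}) 1 1
  rw [h3, h4, mod_eq_of_lt one_lt_omega0] at h2
  have h5 := natCast_mod_omega0.{u} (m + 1)
  push_cast at h5 ⊢
  rw [h5] at h2
  exact h2

/-- The nonzero ordinals that commute with `ω + 1` are the powers of `ω + 1`. -/
theorem commute_omega0_add_one_iff {x : Ordinal.{u}} :
    (x * (ω + 1) = (ω + 1) * x ∧ x * ω ≠ x) ↔ ∃ j : ℕ, x = (ω + 1) ^ j := by
  constructor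
  · rintro ⟨h, hx⟩
    rw [Ne, mul_omega0_eq_self_iff] at hx
    induction x using WellFoundedLT.induction with
    | ind x ih =>
      rcases lt_or_ge x ω with hlt | hle
      · exact ⟨0, by rw [pow_zero]; exact eq_one_of_commute_of_lt_omega0 hx hlt h⟩
      -- With `x * ω = ω ^ (1 + f + 1)` and `f + 1 = 1 + g`, the factor `ω ^ (1 + g)` is a limit.
      obtain ⟨f, hf⟩ := exists_add_of_le (Order.one_le_iff_pos.2 (log_pos one_lt_omega0 hx hle))
      obtain ⟨g, hg⟩ := exists_add_of_le (le_add_self : (1 : Ordinal) ≤ f + 1)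
      have hz : x * ω = (ω + 1) * (ω * ω ^ g) := by
        rw [← mul_assoc, omega0_add_one_mul_omega0, mul_omega0_eq_opow hx, hf, add_assoc, hg,
          opow_one_add, opow_one_add, pow_two, mul_assoc]
      obtain ⟨y, hxy, hy⟩ := exists_eq_mul_of_commute (q := 1) (by rw [mul_one]) hz h
      have hy0 : y ≠ 0 := by rintro rfl; simp at hxy; exact hx hxy
      have hyx : y < x := by
        rw [hxy, ← hy]
        calc y = y * 1 := (mul_one y).symm
          _ < y * (ω + 1) := mul_lt_mul_of_pos_left
            (one_lt_omega0.trans_le le_self_add) (pos_iff_ne_zero.2 hy0)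
      obtain ⟨j, hj⟩ := ih y hyx hy hy0
      exact ⟨j + 1, by rw [hxy, hj, pow_succ']⟩
  · rintro ⟨j, rfl⟩
    refine ⟨by rw [← pow_succ, ← pow_succ'], ?_⟩
    rw [Ne, mul_omega0_eq_self_iff]
    exact pow_ne_zero _ (by simp)

/-! ### Ordinals whose commutant is governed by the degree -/

/-- `c` is *primitive* among the ordinals below `B`: it has no finite left factor other than `1`,
and the only ordinal of smaller degree that commutes with it is `1`. Here `x * (ω + 1) * t * ω =
c * ω`, for a power `t` of `ω + 1`, says that the degree of `x` is smaller than that of `c`. -/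
def IsPrimitive (B c : Ordinal.{u}) : Prop :=
  (∀ x < B, ∀ y < B, x * y = c → x * ω = ω → x = 1) ∧
  ∀ x < B, ∀ t < B, x * c = c * x → (t * (ω + 1) = (ω + 1) * t ∧ t * ω ≠ t) →
    x * (ω + 1) * t * ω = c * ω → x = 1

theorem pow_lt_of_isPrincipal {B c : Ordinal.{u}} (hB : IsPrincipal (· * ·) B) (h1 : 1 < B)
    (hc : c < B) (k : ℕ) : c ^ k < B := by
  induction k with
  | zero => simpa using h1
  | succ k ih => rw [pow_succ]; exact hB ih hc

theorem natCast_mul_omega0_mul_add_one {m : ℕ} (hm : m ≠ 0) (q : Ordinal.{u}) :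
    (m : Ordinal.{u}) * (ω * q + 1) = ω * q + m := by
  rw [mul_add, mul_one, ← mul_assoc, natCast_mul_omega0 (Nat.pos_of_ne_zero hm)]

/-- An ordinal without nontrivial finite left factors has the form `ω * q + 1`: otherwise `2` is a
left factor of `ω * q = 2 * (ω * q)`, and `r > 1` one of `ω * q + r = r * (ω * q + 1)`. -/
theorem IsPrimitive.exists_eq_omega0_mul_add_one {B c : Ordinal.{u}} (hωB : ω < B)
    (hcB : c < B) (h : IsPrimitive B c) :
    ∃ q, c = ω * q + 1 := by
  obtain ⟨r, hr⟩ := lt_omega0.1 (mod_lt c omega0_ne_zero)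
  have hc' := div_add_mod c ω
  rw [hr] at hc'
  have hnat (k : ℕ) : (k : Ordinal.{u}) < B := (natCast_lt_omega0 k).trans hωB
  by_cases hr0 : r = 0
  · exfalso
    subst hr0
    have h2 : (2 : ℕ) * c = c := by
      rw [← hc', Nat.cast_zero, add_zero, ← mul_assoc, natCast_mul_omega0 two_pos]
    have := h.1 _ (hnat 2) c hcB h2 (natCast_mul_omega0 two_pos)
    norm_num at this
  · have h1 := natCast_mul_omega0_mul_add_one hr0 (c / ω)
    rw [hc'] at h1
    have hle : ω * (c / ω) + 1 ≤ c := by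
      conv_rhs => rw [← hc']
      have : (1 : Ordinal.{u}) ≤ r := by exact_mod_cast Nat.one_le_iff_ne_zero.2 hr0
      gcongr
    have := h.1 _ (hnat r) _ (hle.trans_lt hcB) h1 (natCast_mul_omega0 (Nat.pos_of_ne_zero hr0))
    rw [this] at hc'
    exact ⟨_, hc'.symm⟩

/-- If `x` commutes with a primitive `c` of degree `n`, then `n` divides the degree of `x`. -/
theorem IsPrimitive.dvd_of_commute {B c : Ordinal.{u}} {n : ℕ} (hB : IsPrincipal (· * ·) B)
    (hωB : ω + 1 < B) (hcB : c < B) (h : IsPrimitive B c) (hn : n ≠ 0) (hc : c * ω = ω ^ (n + 1))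
    {x : Ordinal.{u}} (hxB : x < B) (hxc : x * c = c * x) {k : ℕ} (hk : x * ω = ω ^ (k + 1)) :
    n ∣ k := by
  have hω : ω < B := lt_of_le_of_lt le_self_add hωB
  obtain ⟨q, hq⟩ := h.exists_eq_omega0_mul_add_one hω hcB
  induction k using Nat.strong_induction_on generalizing x with
  | _ k ih =>
    rcases lt_or_ge k n with hkn | hkn
    -- The power `t = (ω + 1) ^ j` compensates the difference of the degrees.
    · obtain ⟨j, rfl⟩ : ∃ j, n = k + 1 + j := ⟨n - (k + 1), by omega⟩
      have hx1 : x = 1 := by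
        refine h.2 x hxB ((ω + 1) ^ j)
          (pow_lt_of_isPrincipal hB (one_lt_omega0.trans hω) hωB j) hxc
          (commute_omega0_add_one_iff.2 ⟨j, rfl⟩) ?_
        rw [hc]
        exact mul_mul_omega0 (mul_mul_omega0 hk omega0_add_one_mul_omega0)
          (omega0_add_one_pow_mul_omega0 j)
      rw [hx1, one_mul] at hk
      have := pow_omega0_inj (m := 1) (n := k + 1) (by rw [pow_one]; exact hk)
      have hk0 : k = 0 := by omega
      rw [hk0]; exact dvd_zero _
    · obtain ⟨l, rfl⟩ := exists_add_of_le hkn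
      have hz : x * ω = c * ω ^ (l + 1) := by
        rw [hk, pow_succ' ω l, ← mul_assoc, hc, ← pow_add]; congr 1; ring
      obtain ⟨y, hxy, hy⟩ := exists_eq_mul_of_commute hq hz hxc
      have hc0 : c ≠ 0 := by rw [hq]; simp
      have hyx : y ≤ x := hxy ▸ le_mul_right y (pos_iff_ne_zero.2 hc0)
      have hx := lt_of_mul_omega0 hk
      have hy0 : y ≠ 0 := by
        rintro rfl
        rw [hxy, mul_zero, zero_mul] at hk
        exact pow_ne_zero _ omega0_ne_zero hk.symm
      obtain ⟨e, -, he⟩ := exists_mul_omega0_eq_pow hy0 (hyx.trans_lt hx)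
      have h2 := mul_mul_omega0 hc he
      rw [← hxy, hk] at h2
      have h3 := pow_omega0_inj h2
      have hel : e = l := by omega
      subst hel
      exact dvd_add dvd_rfl (ih e (by omega) (hyx.trans_lt hxB) hy he)

theorem one_add_omega0_pow {n : ℕ} (hn : n ≠ 0) : 1 + (ω : Ordinal.{u}) ^ n = ω ^ n := by
  rw [← opow_natCast]
  apply add_omega0_opow
  rw [opow_natCast]
  exact one_lt_pow₀ one_lt_omega0 hn

theorem omega0_pow_add_one_mul_omega0 {n : ℕ} (hn : n ≠ 0) :
    ((ω : Ordinal.{u}) ^ n + 1) * ω = ω ^ (n + 1) := by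
  rw [add_mul_of_isSuccLimit (one_add_omega0_pow hn) isSuccLimit_omega0, pow_succ]

/-- The ordinal `ω ^ n + 1` is primitive: if `x` commutes with it and is smaller than `ω ^ n`, then
`x` is the remainder modulo `ω ^ n` of `x * ω ^ n + x = (ω ^ n + 1) * x`, which is `0` or `1`. -/
theorem isPrimitive_omega0_pow_add_one (B : Ordinal.{u}) {n : ℕ} (hn : n ≠ 0) :
    IsPrimitive B (ω ^ n + 1) := by
  obtain ⟨m, rfl⟩ := Nat.exists_eq_succ_of_ne_zero hn
  constructor
  · rintro x - y - hxy hx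
    have hx0 : x ≠ 0 := by
      rintro rfl
      rw [zero_mul] at hx
      exact omega0_ne_zero hx.symm
    have hxω : x < ω := by simpa using lt_of_mul_omega0 (n := 1) (by simpa using hx)
    obtain ⟨k, rfl⟩ := lt_omega0.1 hxω
    have h1 := congrArg (· % ω) hxy
    simp only [pow_succ', mul_add_mod_self, mod_eq_of_lt one_lt_omega0] at h1
    obtain ⟨l, hl⟩ := lt_omega0.1 (mod_lt y omega0_ne_zero)
    have hy := div_add_mod y ω
    rw [← hy, mul_add, ← mul_assoc, hx, mul_add_mod_self, hl] at h1
    have h2 := natCast_mod_omega0.{u} (k * l)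
    rw [natCast_mul, h1] at h2
    have h3 : k * l = 1 := by exact_mod_cast h2.symm
    rw [Nat.eq_one_of_mul_eq_one_right h3, Nat.cast_one]
  · rintro x - t - hxc ht hdeg
    obtain ⟨j, rfl⟩ := commute_omega0_add_one_iff.1 ht
    rw [omega0_pow_add_one_mul_omega0 hn] at hdeg
    have hx0 : x ≠ 0 := by
      rintro rfl
      simp only [zero_mul] at hdeg
      exact pow_ne_zero _ omega0_ne_zero hdeg.symm
    have hxle : x < ω ^ (m + 1 + 1) := by
      refine lt_of_le_of_lt ?_ (lt_of_mul_omega0 hdeg)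
      rw [mul_assoc]
      exact le_mul_left x (pos_iff_ne_zero.2 (mul_ne_zero (by simp) (pow_ne_zero _ (by simp))))
    obtain ⟨e, -, he⟩ := exists_mul_omega0_eq_pow hx0 hxle
    have h1 := mul_mul_omega0 (mul_mul_omega0 he omega0_add_one_mul_omega0)
      (omega0_add_one_pow_mul_omega0 j)
    rw [hdeg] at h1
    have h2 := pow_omega0_inj h1
    have hxlt : x < ω ^ (m + 1) :=
      (lt_of_mul_omega0 he).trans_le (pow_le_pow_right₀ one_lt_omega0.le (by omega))
    have h3 : x * (ω ^ (m + 1) + 1) = ω ^ (m + 1) * ω ^ e + x := by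
      rw [mul_add, mul_one, pow_succ' ω m, ← mul_assoc, he, ← pow_add, ← pow_succ', ← pow_add]
      congr 2; omega
    obtain ⟨r, hr⟩ := lt_omega0.1 (mod_lt x omega0_ne_zero)
    have hx := div_add_mod x ω
    rw [hr] at hx
    have h4 : (ω ^ (m + 1) + 1) * x =
        ω ^ (m + 1) * (ω * (x / ω)) + (ω ^ (m + 1) + 1) * r := by
      conv_lhs => rw [← hx, mul_add, ← mul_assoc, omega0_pow_add_one_mul_omega0 hn]
      rw [pow_succ ω (m + 1), mul_assoc]
    rw [hxc, h4] at h3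
    have h5 := congrArg (· % ω ^ (m + 1)) h3
    simp only [mul_add_mod_self, mod_eq_of_lt hxlt] at h5
    rcases Nat.eq_zero_or_pos r with rfl | hrpos
    · simp only [Nat.cast_zero, mul_zero, zero_mod] at h5
      exact absurd h5.symm hx0
    · obtain ⟨r, rfl⟩ : ∃ s, r = s + 1 := ⟨r - 1, by omega⟩
      rw [Nat.cast_add_one, add_mul_add_one _ (one_add_omega0_pow hn), mul_add_mod_self,
        mod_eq_of_lt (one_lt_pow₀ one_lt_omega0 hn)] at h5
      exact h5.symm

/-! ### Squares of exponents -/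

/-- The ordinals `X` and `Y` of equal degree commute with `c` and `d` respectively, and no smaller
degree except `0` is shared by two ordinals below `B` with these properties. As in `IsPrimitive`,
the power `t` of `ω + 1` expresses that the degree of `x` is smaller than that of `X`; and
`x * ω = ω` says that the degree of `x` is `0`. -/
def IsLeastCommuting (B c d X Y : Ordinal.{u}) : Prop :=
  (X * c = c * X ∧ Y * d = d * Y ∧ X * ω = Y * ω) ∧
  ∀ x < B, ∀ y < B, ∀ t < B, x * c = c * x → y * d = d * y → x * ω = y * ω →
    (t * (ω + 1) = (ω + 1) * t ∧ t * ω ≠ t) → x * (ω + 1) * t * ω = X * ω → x * ω = ω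

/-- The degrees `i + 1` and `i + 2` are coprime, so that the least common multiple of the degrees
is their product `i ^ 2 + 3 * i + 2`, whence `s = i ^ 2`. -/
theorem exists_isLeastCommuting_iff {B : Ordinal.{u}} (hB : IsPrincipal (· * ·) B)
    (hωB : ω + 1 < B) (hpow : ∀ n : ℕ, ω ^ n + 1 < B) (i s : ℕ) :
    (∃ c < B, ∃ d < B, ∃ X < B, ∃ Y < B, (IsPrimitive B c ∧ c * ω = (ω + 1) ^ i * (ω + 1) * ω) ∧
      (IsPrimitive B d ∧ d * ω = (ω + 1) ^ i * (ω + 1) * (ω + 1) * ω) ∧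
      IsLeastCommuting B c d X Y ∧
      X * ω = (ω + 1) ^ s * (ω + 1) ^ i * (ω + 1) ^ i * (ω + 1) ^ i * (ω + 1) * (ω + 1) * ω) ↔
    s = i ^ 2 := by
  have hcop : Nat.Coprime (i + 1) (i + 2) := Nat.coprime_self_add_right.2 (Nat.coprime_one_right _)
  have h1B : 1 < B := one_lt_omega0.trans (lt_of_le_of_lt le_self_add hωB)
  have e1 : ((ω : Ordinal.{u}) + 1) ^ i * (ω + 1) * ω = ω ^ (i + 1 + 1) := by
    rw [← pow_succ, omega0_add_one_pow_mul_omega0]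
  have e2 : ((ω : Ordinal.{u}) + 1) ^ i * (ω + 1) * (ω + 1) * ω = ω ^ (i + 2 + 1) := by
    rw [← pow_succ, ← pow_succ, omega0_add_one_pow_mul_omega0]
  have e3 : ((ω : Ordinal.{u}) + 1) ^ s * (ω + 1) ^ i * (ω + 1) ^ i * (ω + 1) ^ i * (ω + 1) *
      (ω + 1) * ω = ω ^ (s + 3 * i + 2 + 1) := by
    rw [← pow_add, ← pow_add, ← pow_add, ← pow_succ, ← pow_succ, omega0_add_one_pow_mul_omega0]
    congr 1; ring
  rw [e1, e2, e3]
  have key {c d : Ordinal.{u}} (hc : c * ω = ω ^ (i + 1 + 1)) (hd : d * ω = ω ^ (i + 2 + 1)) :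
      c ^ (i + 2) * ω = ω ^ ((i + 1) * (i + 2) + 1) ∧
      d ^ (i + 1) * ω = ω ^ ((i + 1) * (i + 2) + 1) :=
    ⟨pow_mul_omega0 hc _, by rw [pow_mul_omega0 hd, mul_comm (i + 2)]⟩
  constructor
  · rintro ⟨c, hcB, d, hdB, X, hXB, Y, hYB, ⟨hc, hcd⟩, ⟨hd, hdd⟩, ⟨⟨hX, hY, hXY⟩, hmin⟩, hXd⟩
    have d1 := hc.dvd_of_commute hB hωB hcB (by omega) hcd hXB hX hXd
    have d2 := hd.dvd_of_commute hB hωB hdB (by omega) hdd hYB hY (hXY ▸ hXd)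
    have hdvd := hcop.mul_dvd_of_dvd_of_dvd d1 d2
    have hle := Nat.le_of_dvd (by omega) hdvd
    rcases hle.lt_or_eq with hlt | heq
    -- Otherwise `c ^ (i + 2)` and `d ^ (i + 1)` share a smaller positive degree.
    · exfalso
      obtain ⟨j, hj⟩ := Nat.exists_eq_add_of_lt hlt
      obtain ⟨k1, k2⟩ := key hcd hdd
      have := hmin (c ^ (i + 2)) (pow_lt_of_isPrincipal hB h1B hcB _)
        (d ^ (i + 1)) (pow_lt_of_isPrincipal hB h1B hdB _) ((ω + 1) ^ j)
        (pow_lt_of_isPrincipal hB h1B hωB _)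
        (by rw [← pow_succ, ← pow_succ']) (by rw [← pow_succ, ← pow_succ']) (k1.trans k2.symm)
        (commute_omega0_add_one_iff.2 ⟨j, rfl⟩) (by
          rw [mul_mul_omega0 (mul_mul_omega0 k1 omega0_add_one_mul_omega0)
            (omega0_add_one_pow_mul_omega0 j), hXd, hj]
          congr 1; ring)
      rw [k1] at this
      have := pow_omega0_inj (n := 1) (by rw [this, pow_one])
      have hpos : 0 < (i + 1) * (i + 2) := by positivity
      omega
    · nlinarith
  · rintro rfl
    have hcd := omega0_pow_add_one_mul_omega0.{u} (n := i + 1) (by omega)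
    have hdd := omega0_pow_add_one_mul_omega0.{u} (n := i + 2) (by omega)
    have hc := isPrimitive_omega0_pow_add_one.{u} B (n := i + 1) (by omega)
    have hd := isPrimitive_omega0_pow_add_one.{u} B (n := i + 2) (by omega)
    obtain ⟨k1, k2⟩ := key hcd hdd
    refine ⟨_, hpow (i + 1), _, hpow (i + 2),
      _, pow_lt_of_isPrincipal hB h1B (hpow (i + 1)) (i + 2),
      _, pow_lt_of_isPrincipal hB h1B (hpow (i + 2)) (i + 1), ⟨hc, hcd⟩, ⟨hd, hdd⟩,
      ⟨⟨by rw [← pow_succ, ← pow_succ'], by rw [← pow_succ, ← pow_succ'], k1.trans k2.symm⟩, ?_⟩,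
      by rw [k1]; congr 1; ring⟩
    intro x hxB y hyB t htB hxc hyd hxy ht hdeg
    obtain ⟨j, rfl⟩ := commute_omega0_add_one_iff.1 ht
    rw [k1] at hdeg
    have hx0 : x ≠ 0 := by
      rintro rfl
      simp only [zero_mul] at hdeg
      exact pow_ne_zero _ omega0_ne_zero hdeg.symm
    have hxle : x < ω ^ ((i + 1) * (i + 2) + 1) := by
      refine lt_of_le_of_lt ?_ (lt_of_mul_omega0 hdeg)
      rw [mul_assoc]
      exact le_mul_left x (pos_iff_ne_zero.2 (mul_ne_zero (by simp) (pow_ne_zero _ (by simp))))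
    obtain ⟨e, -, he⟩ := exists_mul_omega0_eq_pow hx0 hxle
    have h1 := mul_mul_omega0 (mul_mul_omega0 he omega0_add_one_mul_omega0)
      (omega0_add_one_pow_mul_omega0 j)
    rw [hdeg] at h1
    have h2 := pow_omega0_inj h1
    have d1 := hc.dvd_of_commute hB hωB (hpow _) (by omega) hcd hxB hxc he
    have d2 := hd.dvd_of_commute hB hωB (hpow _) (by omega) hdd hyB hyd (hxy ▸ he)
    have he0 := Nat.eq_zero_of_dvd_of_lt (hcop.mul_dvd_of_dvd_of_dvd d1 d2) (by omega)
    rw [he, he0, zero_add, pow_one]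

end Ordinal

/-! ### Predicates definable by `∃*∀ᵏ`-formulas -/

section Definability

open FirstOrder Language

variable {L : Language} {M : Type*} [L.Structure M] {γ δ : Type}

theorem realize_forallBlock {k m : ℕ} (ψ : L.BoundedFormula γ (m + k)) (v : γ → M)
    (u : Fin m → M) :
    (forallBlock k ψ).Realize v u ↔ ∀ w : Fin k → M, ψ.Realize v (Fin.append u w) := by
  induction k with
  | zero =>
    rw [Unique.forall_iff, forallBlock, Fin.append_right_nil u _ rfl]
    rfl
  | succ k ih =>
    rw [forallBlock, ih]
    simp only [BoundedFormula.realize_all]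
    constructor
    · intro h w
      have := h (Fin.init w) (w (Fin.last k))
      rwa [← Fin.append_snoc, Fin.snoc_init_self] at this
    · intro h w x
      rw [← Fin.append_snoc]
      exact h _

variable (L) in
/-- `P` is the set of solutions of a quantifier-free formula. -/
def QFDefinable (P : (γ → M) → Prop) : Prop :=
  ∃ φ : L.Formula γ, φ.IsQF ∧ ∀ v, φ.Realize v ↔ P v

namespace QFDefinable

theorem and {P Q : (γ → M) → Prop} : QFDefinable L P → QFDefinable L Q →
    QFDefinable L fun v => P v ∧ Q v
  | ⟨φ, hφ, h⟩, ⟨ψ, hψ, h'⟩ =>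
    ⟨φ ⊓ ψ, hφ.inf hψ, fun v => by rw [Formula.realize_inf, h, h']⟩

theorem imp {P Q : (γ → M) → Prop} : QFDefinable L P → QFDefinable L Q →
    QFDefinable L fun v => P v → Q v
  | ⟨φ, hφ, h⟩, ⟨ψ, hψ, h'⟩ =>
    ⟨φ.imp ψ, hφ.imp hψ, fun v => by rw [Formula.realize_imp, h, h']⟩

theorem not {P : (γ → M) → Prop} : QFDefinable L P → QFDefinable L fun v => ¬ P v
  | ⟨φ, hφ, h⟩ => ⟨φ.not, hφ.not, fun v => by rw [Formula.realize_not, h]⟩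

theorem true : QFDefinable L fun _ : γ → M => True :=
  ⟨⊤, BoundedFormula.IsQF.top, fun v => by simp [Formula.realize_top]⟩

theorem forall_mem {ι : Type} (s : Finset ι) {P : ι → (γ → M) → Prop}
    (h : ∀ i, QFDefinable L (P i)) : QFDefinable L fun v => ∀ i ∈ s, P i v := by
  classical
  induction s using Finset.induction_on with
  | empty => simpa using true
  | insert i s _ ih => simpa using (h i).and ih

theorem comap {P : (γ → M) → Prop} (f : γ → δ) :
    QFDefinable L P → QFDefinable L fun v : δ → M => P (v ∘ f)
  | ⟨φ, hφ, h⟩ => ⟨φ.relabel f, hφ.relabel _, fun v => by rw [Formula.realize_relabel, h]⟩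

end QFDefinable

variable (L) in
/-- `P` is the set of solutions of an `∃*∀ᵏ`-formula. The variables bound by the existential and by
the universal quantifiers are indexed by `Fin m` and `Fin k` in the matrix `Q`. -/
def EADefinable (k : ℕ) (P : (γ → M) → Prop) : Prop :=
  ∃ (m : ℕ) (Q : ((γ ⊕ Fin m) ⊕ Fin k → M) → Prop), QFDefinable L Q ∧
    ∀ v, P v ↔ ∃ u : Fin m → M, ∀ w : Fin k → M, Q (Sum.elim (Sum.elim v u) w)

namespace EADefinable

variable {k : ℕ}

theorem exists_formula {P : (γ → M) → Prop} (hP : EADefinable L k P) :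
    ∃ φ : L.Formula γ, IsExistsForall k φ ∧ ∀ v, φ.Realize v ↔ P v := by
  obtain ⟨m, Q, ⟨φ, hφ, h⟩, hP⟩ := hP
  let g : (γ ⊕ Fin m) ⊕ Fin k → γ ⊕ Fin (m + k) :=
    Sum.elim (Sum.map id (Fin.castAdd k)) (Sum.inr ∘ Fin.natAdd m)
  refine ⟨(forallBlock k (BoundedFormula.relabel g φ : L.BoundedFormula γ (m + k))).exs,
    ⟨m, _, hφ.relabel g, rfl⟩, fun v => ?_⟩
  rw [BoundedFormula.realize_exs, hP]
  refine exists_congr fun u => ?_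
  rw [realize_forallBlock]
  refine forall_congr' fun w => ?_
  rw [← h]
  let xs : Fin (m + k) → M := Fin.append u w
  refine (BoundedFormula.realize_relabel (m := m + k) (n := 0) (xs := xs)).trans ?_
  rw [Formula.Realize]
  have hv : Sum.elim v (xs ∘ Fin.castAdd 0) ∘ g = Sum.elim (Sum.elim v u) w := by
    funext i
    rcases i with (i | i) | i
    · rfl
    · exact Fin.append_left u w i
    · exact Fin.append_right u w i
  rw [hv]
  exact iff_of_eq (congrArg _ (Subsingleton.elim _ _))

/-- The existentially bound variables may be indexed by any finite type. -/
theorem of_finite {β : Type} [Finite β] {P : (γ → M) → Prop}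
    {Q : ((γ ⊕ β) ⊕ Fin k → M) → Prop} (hQ : QFDefinable L Q)
    (h : ∀ v, P v ↔ ∃ u : β → M, ∀ w : Fin k → M, Q (Sum.elim (Sum.elim v u) w)) :
    EADefinable L k P := by
  obtain ⟨m, ⟨e⟩⟩ := Finite.exists_equiv_fin β
  refine ⟨m, _, hQ.comap (Sum.map (Sum.map id e) id), fun v => ?_⟩
  rw [h]
  simp only [Sum.elim_comp_map, Function.comp_id]
  exact ⟨fun ⟨u, hu⟩ => ⟨u ∘ e.symm, by simpa [Function.comp_assoc] using hu⟩,
    fun ⟨u, hu⟩ => ⟨u ∘ e, hu⟩⟩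

theorem of_qf [Nonempty M] {P : (γ → M) → Prop} (h : QFDefinable L P) : EADefinable L k P :=
  of_finite (β := Empty) (h.comap (Sum.inl ∘ Sum.inl)) fun v => by
    simp [← Function.comp_assoc]

theorem of_forall {P : (γ → M) → Prop} {Q : (γ ⊕ Fin k → M) → Prop} (hQ : QFDefinable L Q)
    (h : ∀ v, P v ↔ ∀ w : Fin k → M, Q (Sum.elim v w)) : EADefinable L k P :=
  of_finite (β := Empty) (hQ.comap (Sum.map Sum.inl id)) fun v => by
    simp [Sum.elim_comp_map, h]

/-- A conjunction needs no further universal quantifiers, since these are shared. -/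
theorem and {P P' : (γ → M) → Prop} (h : EADefinable L k P) (h' : EADefinable L k P') :
    EADefinable L k fun v => P v ∧ P' v := by
  obtain ⟨m, Q, hQ, hP⟩ := h
  obtain ⟨m', Q', hQ', hP'⟩ := h'
  refine of_finite (β := Fin m ⊕ Fin m')
    ((hQ.comap (Sum.map (Sum.map id Sum.inl) id)).and
      (hQ'.comap (Sum.map (Sum.map id Sum.inr) id))) fun v => ?_
  simp only [Sum.elim_comp_map, Function.comp_id, hP, hP', forall_and]
  exact ⟨fun ⟨⟨u, hu⟩, ⟨u', hu'⟩⟩ => ⟨Sum.elim u u', hu, hu'⟩,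
    fun ⟨u, hu⟩ => ⟨⟨_, hu.1⟩, ⟨_, hu.2⟩⟩⟩

theorem comap {P : (γ → M) → Prop} (f : γ → δ) (h : EADefinable L k P) :
    EADefinable L k fun v : δ → M => P (v ∘ f) := by
  obtain ⟨m, Q, hQ, hP⟩ := h
  refine ⟨m, _, hQ.comap (Sum.map (Sum.map f id) id), fun v => ?_⟩
  simp only [Sum.elim_comp_map, Function.comp_id, hP]

theorem exists' [Finite δ] {P : (γ ⊕ δ → M) → Prop} (h : EADefinable L k P) :
    EADefinable L k fun v : γ → M => ∃ u : δ → M, P (Sum.elim v u) := by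
  obtain ⟨m, Q, hQ, hP⟩ := h
  refine of_finite (β := δ ⊕ Fin m) (hQ.comap (Sum.map (Equiv.sumAssoc γ δ (Fin m)) id))
    fun v => ?_
  have e (u : δ ⊕ Fin m → M) : Sum.elim v u ∘ Equiv.sumAssoc γ δ (Fin m) =
      Sum.elim (Sum.elim v (u ∘ Sum.inl)) (u ∘ Sum.inr) := by
    funext i
    rcases i with (i | i) | i <;> rfl
  simp only [Sum.elim_comp_map, Function.comp_id, hP, e]
  exact ⟨fun ⟨u, u', h⟩ => ⟨Sum.elim u u', h⟩, fun ⟨u, h⟩ => ⟨_, _, h⟩⟩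

theorem congr {P P' : (γ → M) → Prop} (h : EADefinable L k P) (e : ∀ v, P' v ↔ P v) :
    EADefinable L k P' := by
  rwa [show P' = P from funext fun v => propext (e v)]

end EADefinable

end Definability

/-! ### Definability in the structure of ordinals -/

namespace OmegaDomain

open FirstOrder Language Ordinal

variable {lam : Ordinal.{u}} {h : 0 < lam} {γ : Type}

theorem one_lt (h : 0 < lam) : 1 < ω ^ ω ^ lam := one_lt_omega0.trans (omega_lt h)

instance : Nonempty (OmegaDomain lam h) := ⟨⟨1, one_lt h⟩⟩

/-- The function `f` of an assignment is the value of a term, considered as an ordinal. -/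
def IsTermFun (f : (γ → OmegaDomain lam h) → Ordinal.{u}) : Prop :=
  ∃ t : ordMulLang.Term γ, ∀ v, (t.realize v).1 = f v

theorem isTermFun_var (i : γ) : IsTermFun fun v : γ → OmegaDomain lam h => (v i).1 :=
  ⟨Term.var i, fun _ => rfl⟩

theorem isTermFun_one : IsTermFun fun _ : γ → OmegaDomain lam h => 1 :=
  ⟨Term.func (OrdMulFunc.one : ordMulLang.Functions 0) ![], fun _ => rfl⟩

theorem isTermFun_omega : IsTermFun fun _ : γ → OmegaDomain lam h => ω :=
  ⟨Term.func (OrdMulFunc.omega : ordMulLang.Functions 0) ![], fun _ => rfl⟩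

theorem isTermFun_omegaAddOne : IsTermFun fun _ : γ → OmegaDomain lam h => ω + 1 :=
  ⟨Term.func (OrdMulFunc.omegaAddOne : ordMulLang.Functions 0) ![], fun _ => rfl⟩

theorem IsTermFun.mul {f g : (γ → OmegaDomain lam h) → Ordinal.{u}} :
    IsTermFun f → IsTermFun g → IsTermFun fun v => f v * g v
  | ⟨s, hs⟩, ⟨t, ht⟩ =>
    ⟨Term.func (OrdMulFunc.mul : ordMulLang.Functions 2) ![s, t], fun v =>
      congrArg₂ (· * ·) (hs v) (ht v)⟩

theorem IsTermFun.eq {f g : (γ → OmegaDomain lam h) → Ordinal.{u}} :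
    IsTermFun f → IsTermFun g → QFDefinable ordMulLang fun v => f v = g v
  | ⟨s, hs⟩, ⟨t, ht⟩ =>
    ⟨s.equal t, (BoundedFormula.IsAtomic.equal _ _).isQF, fun v => by
      change _ ↔ f v = g v
      rw [Formula.realize_equal, ← hs, ← ht]; exact Subtype.ext_iff⟩

theorem IsTermFun.commute {f g : (γ → OmegaDomain lam h) → Ordinal.{u}} (hf : IsTermFun f)
    (hg : IsTermFun g) : QFDefinable ordMulLang fun v => f v * g v = g v * f v :=
  (hf.mul hg).eq (hg.mul hf)

theorem IsTermFun.isPow {f : (γ → OmegaDomain lam h) → Ordinal.{u}} (hf : IsTermFun f) :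
    QFDefinable ordMulLang fun v => f v * (ω + 1) = (ω + 1) * f v ∧ f v * ω ≠ f v :=
  (hf.commute isTermFun_omegaAddOne).and ((hf.mul isTermFun_omega).eq hf).not

theorem forall_lt_iff {P : Ordinal.{u} → Prop} :
    (∀ x < ω ^ ω ^ lam, P x) ↔ ∀ x : OmegaDomain lam h, P x.1 :=
  ⟨fun H x => H x.1 x.2, fun H x hx => H ⟨x, hx⟩⟩

theorem exists_lt_iff {P : Ordinal.{u} → Prop} :
    (∃ x < ω ^ ω ^ lam, P x) ↔ ∃ x : OmegaDomain lam h, P x.1 :=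
  ⟨fun ⟨x, hx, H⟩ => ⟨⟨x, hx⟩, H⟩, fun ⟨x, H⟩ => ⟨x.1, x.2, H⟩⟩

theorem forall_fin_two {M : Type*} {k : ℕ} {P : M → M → Prop} :
    (∀ w : Fin (k + 2) → M, P (w 0) (w 1)) ↔ ∀ x y, P x y :=
  ⟨fun H x y => H (Fin.cons x (Fin.cons y fun _ => x)), fun H _ => H _ _⟩

theorem forall_fin_three {M : Type*} {k : ℕ} {P : M → M → M → Prop} :
    (∀ w : Fin (k + 3) → M, P (w 0) (w 1) (w 2)) ↔ ∀ x y z, P x y z :=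
  ⟨fun H x y z => H (Fin.cons x (Fin.cons y (Fin.cons z fun _ => x))), fun H _ => H _ _ _⟩

theorem eaDefinable_isPrimitive (i : γ) :
    EADefinable ordMulLang 6 fun v : γ → OmegaDomain lam h =>
      IsPrimitive (ω ^ ω ^ lam) (v i).1 := by
  have c := isTermFun_var (lam := lam) (h := h) (Sum.inl i : γ ⊕ Fin 6)
  have x := isTermFun_var (lam := lam) (h := h) (Sum.inr 0 : γ ⊕ Fin 6)
  have y := isTermFun_var (lam := lam) (h := h) (Sum.inr 1 : γ ⊕ Fin 6)
  refine (EADefinable.of_forall (((x.mul y).eq c).imp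
    (((x.mul isTermFun_omega).eq isTermFun_omega).imp (x.eq isTermFun_one))) fun v => ?_).and
    (EADefinable.of_forall ((x.commute c).imp (y.isPow.imp
      (((((x.mul isTermFun_omegaAddOne).mul y).mul isTermFun_omega).eq
        (c.mul isTermFun_omega)).imp (x.eq isTermFun_one)))) fun v => ?_)
  · simp only [forall_lt_iff (h := h)]
    exact (forall_fin_two (k := 4) (M := OmegaDomain lam h)).symm
  · simp only [forall_lt_iff (h := h)]
    exact (forall_fin_two (k := 4) (M := OmegaDomain lam h)).symm

theorem eaDefinable_isLeastCommuting (i j k l : γ) :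
    EADefinable ordMulLang 6 fun v : γ → OmegaDomain lam h =>
      IsLeastCommuting (ω ^ ω ^ lam) (v i).1 (v j).1 (v k).1 (v l).1 := by
  have var (n : γ) := isTermFun_var (lam := lam) (h := h) n
  have c := isTermFun_var (lam := lam) (h := h) (Sum.inl i : γ ⊕ Fin 6)
  have d := isTermFun_var (lam := lam) (h := h) (Sum.inl j : γ ⊕ Fin 6)
  have X := isTermFun_var (lam := lam) (h := h) (Sum.inl k : γ ⊕ Fin 6)
  have x := isTermFun_var (lam := lam) (h := h) (Sum.inr 0 : γ ⊕ Fin 6)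
  have y := isTermFun_var (lam := lam) (h := h) (Sum.inr 1 : γ ⊕ Fin 6)
  have t := isTermFun_var (lam := lam) (h := h) (Sum.inr 2 : γ ⊕ Fin 6)
  refine (EADefinable.of_qf (((var k).commute (var i)).and (((var l).commute (var j)).and
    (((var k).mul isTermFun_omega).eq ((var l).mul isTermFun_omega))))).and
    (EADefinable.of_forall ((x.commute c).imp ((y.commute d).imp
      (((x.mul isTermFun_omega).eq (y.mul isTermFun_omega)).imp (t.isPow.imp
        (((((x.mul isTermFun_omegaAddOne).mul t).mul isTermFun_omega).eq
          (X.mul isTermFun_omega)).imp ((x.mul isTermFun_omega).eq isTermFun_omega))))))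
      fun v => ?_)
  simp only [forall_lt_iff (h := h)]
  exact (forall_fin_three (k := 3) (M := OmegaDomain lam h)).symm

theorem exists_fin_four {M : Type*} {P : M → M → M → M → Prop} :
    (∃ w : Fin 4 → M, P (w 0) (w 1) (w 2) (w 3)) ↔ ∃ x y z t, P x y z t :=
  ⟨fun ⟨_, H⟩ => ⟨_, _, _, _, H⟩, fun ⟨x, y, z, t, H⟩ => ⟨![x, y, z, t], H⟩⟩

/-- The graph of `(ω + 1) ^ i ↦ (ω + 1) ^ (i ^ 2)` is definable. -/
theorem eaDefinable_sq (m n : γ) :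
    EADefinable ordMulLang 6 fun v : γ → OmegaDomain lam h =>
      ∃ i : ℕ, (v m).1 = (ω + 1) ^ i ∧ (v n).1 = (ω + 1) ^ (i ^ 2) := by
  have var (k : γ) := isTermFun_var (lam := lam) (h := h) k
  have p := isTermFun_var (lam := lam) (h := h) (Sum.inl m : γ ⊕ Fin 4)
  have q := isTermFun_var (lam := lam) (h := h) (Sum.inl n : γ ⊕ Fin 4)
  have c := isTermFun_var (lam := lam) (h := h) (Sum.inr 0 : γ ⊕ Fin 4)
  have d := isTermFun_var (lam := lam) (h := h) (Sum.inr 1 : γ ⊕ Fin 4)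
  have X := isTermFun_var (lam := lam) (h := h) (Sum.inr 2 : γ ⊕ Fin 4)
  have a {γ : Type} := isTermFun_omegaAddOne (lam := lam) (h := h) (γ := γ)
  have w {γ : Type} := isTermFun_omega (lam := lam) (h := h) (γ := γ)
  refine ((EADefinable.of_qf ((var m).isPow.and (var n).isPow)).and (EADefinable.exists' (δ := Fin 4)
    (((eaDefinable_isPrimitive (Sum.inr 0)).and (.of_qf ((c.mul w).eq ((p.mul a).mul w)))).and
    (((eaDefinable_isPrimitive (Sum.inr 1)).and
      (.of_qf ((d.mul w).eq (((p.mul a).mul a).mul w)))).and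
    ((eaDefinable_isLeastCommuting (Sum.inr 0) (Sum.inr 1) (Sum.inr 2) (Sum.inr 3)).and
    (.of_qf ((X.mul w).eq ((((((q.mul p).mul p).mul p).mul a).mul a).mul w)))))))).congr
    fun v => ?_
  simp only [commute_omega0_add_one_iff, Sum.elim_inl, Sum.elim_inr]
  rw [exists_fin_four (M := OmegaDomain lam h) (P := fun c d X Y =>
      (IsPrimitive (ω ^ ω ^ lam) c.1 ∧ c.1 * ω = (v m).1 * (ω + 1) * ω) ∧
      (IsPrimitive (ω ^ ω ^ lam) d.1 ∧ d.1 * ω = (v m).1 * (ω + 1) * (ω + 1) * ω) ∧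
      IsLeastCommuting (ω ^ ω ^ lam) c.1 d.1 X.1 Y.1 ∧
      X.1 * ω = (v n).1 * (v m).1 * (v m).1 * (v m).1 * (ω + 1) * (ω + 1) * ω)]
  have key (i s : ℕ) := exists_isLeastCommuting_iff
    (isPrincipal_mul_omega0_opow_opow lam) (add_one_lt (omega_lt h) h)
    (fun n => add_one_lt (pow_lt_of_isPrincipal (isPrincipal_mul_omega0_opow_opow lam)
      (one_lt h) (omega_lt h) n) h) i s
  simp only [exists_lt_iff (h := h)] at key
  constructor
  · rintro ⟨i, hm, hn⟩
    refine ⟨⟨⟨i, hm⟩, ⟨_, hn⟩⟩, ?_⟩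
    rw [hm, hn]
    exact (key _ _).2 rfl
  · rintro ⟨⟨⟨i, hm⟩, ⟨s, hn⟩⟩, H⟩
    rw [hm, hn] at H
    exact ⟨i, hm, by rw [hn, (key _ _).1 H]⟩

/-- The graph of `((ω + 1) ^ i, (ω + 1) ^ j) ↦ (ω + 1) ^ (i * j)` is definable, since
`i * j + i * j + i ^ 2 + j ^ 2 = (i + j) ^ 2`. -/
theorem eaDefinable_mul (m n k : γ) :
    EADefinable ordMulLang 6 fun v : γ → OmegaDomain lam h =>
      ∃ i j : ℕ, (v m).1 = (ω + 1) ^ i ∧ (v n).1 = (ω + 1) ^ j ∧ (v k).1 = (ω + 1) ^ (i * j) := by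
  have var (k : γ) := isTermFun_var (lam := lam) (h := h) k
  have w (k : γ ⊕ Fin 4) := isTermFun_var (lam := lam) (h := h) k
  refine ((EADefinable.of_qf (var k).isPow).and (EADefinable.exists' (δ := Fin 4)
    ((eaDefinable_sq (Sum.inl m) (Sum.inr 0)).and ((eaDefinable_sq (Sum.inl n) (Sum.inr 1)).and
    ((eaDefinable_sq (Sum.inr 2) (Sum.inr 3)).and
    (.of_qf (((w (Sum.inr 2)).eq ((w (Sum.inl m)).mul (w (Sum.inl n)))).and
      ((w (Sum.inr 3)).eq ((((w (Sum.inl k)).mul (w (Sum.inl k))).mul (w (Sum.inr 0))).mul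
        (w (Sum.inr 1))))))))))).congr fun v => ?_
  simp only [commute_omega0_add_one_iff, Sum.elim_inl, Sum.elim_inr]
  have hB (i : ℕ) : ((ω : Ordinal.{u}) + 1) ^ i < ω ^ ω ^ lam :=
    pow_lt_of_isPrincipal (isPrincipal_mul_omega0_opow_opow lam) (one_lt h)
      (add_one_lt (omega_lt h) h) i
  constructor
  · rintro ⟨i, j, hm, hn, hk⟩
    refine ⟨⟨_, hk⟩, ![⟨_, hB (i ^ 2)⟩, ⟨_, hB (j ^ 2)⟩, ⟨_, hB (i + j)⟩, ⟨_, hB ((i + j) ^ 2)⟩],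
      ⟨i, hm, rfl⟩, ⟨j, hn, rfl⟩, ⟨i + j, rfl, rfl⟩, ?_, ?_⟩
    · rw [hm, hn, ← pow_add]; rfl
    · rw [hk]
      change (ω + 1) ^ ((i + j) ^ 2) = (ω + 1) ^ (i * j) * (ω + 1) ^ (i * j) *
        (ω + 1) ^ (i ^ 2) * (ω + 1) ^ (j ^ 2)
      simp only [← pow_add]
      congr 1; ring
  · rintro ⟨⟨s, hk⟩, w, ⟨i, hm, h0⟩, ⟨j, hn, h1⟩, ⟨l, h2, h3⟩, h4, h5⟩
    refine ⟨i, j, hm, hn, ?_⟩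
    rw [h2, hm, hn, ← pow_add] at h4
    rw [h3, hk, h0, h1, ← pow_add, ← pow_add, ← pow_add] at h5
    have e4 := omega0_add_one_pow_inj h4
    have e5 := omega0_add_one_pow_inj h5
    subst e4
    rw [hk]
    congr 1
    nlinarith

/-! ### Diophantine equations -/

/-- The graph of the function that a term of arithmetic defines on exponents is definable. The
extra variable `Sum.inr ()` carries the value. -/
theorem eaDefinable_term {p : ℕ} (t : arithLang.Term (Fin p ⊕ Fin 0)) :
    EADefinable ordMulLang 6 fun v : Fin p ⊕ Unit → OmegaDomain lam h =>
      ∃ j : Fin p → ℕ, (∀ i, (v (Sum.inl i)).1 = (ω + 1) ^ j i) ∧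
        (v (Sum.inr ())).1 = (ω + 1) ^ t.realize (Sum.elim j Fin.elim0) := by
  have var (k : Fin p ⊕ Unit) := isTermFun_var (lam := lam) (h := h) k
  have hdom : EADefinable ordMulLang 6 fun v : Fin p ⊕ Unit → OmegaDomain lam h =>
      ∃ j : Fin p → ℕ, ∀ i, (v (Sum.inl i)).1 = (ω + 1) ^ j i := by
    refine (EADefinable.of_qf
      (QFDefinable.forall_mem Finset.univ fun i => (var (Sum.inl i)).isPow)).congr fun v => ?_
    simp only [commute_omega0_add_one_iff, Finset.mem_univ, true_implies]
    exact ⟨fun ⟨j, hj⟩ i => ⟨j i, hj i⟩, fun H => by choose j hj using H; exact ⟨j, hj⟩⟩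
  have hB (i : ℕ) : ((ω : Ordinal.{u}) + 1) ^ i < ω ^ ω ^ lam :=
    pow_lt_of_isPrincipal (isPrincipal_mul_omega0_opow_opow lam) (one_lt h)
      (add_one_lt (omega_lt h) h) i
  -- The exponents of powers of `ω + 1` are unique.
  have uniq {v : Fin p → OmegaDomain lam h} {j j' : Fin p → ℕ}
      (hj : ∀ i, (v i).1 = (ω + 1) ^ j i) (hj' : ∀ i, (v i).1 = (ω + 1) ^ j' i) : j = j' :=
    funext fun i => omega0_add_one_pow_inj ((hj i).symm.trans (hj' i))
  induction t with
  | var i =>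
    rcases i with i | i
    · refine (hdom.and (.of_qf ((var (Sum.inr ())).eq (var (Sum.inl i))))).congr fun v => ?_
      simp only [Term.realize_var, Sum.elim_inl]
      constructor
      · rintro ⟨j, hj, hv⟩
        exact ⟨⟨j, hj⟩, by rw [hv, hj]⟩
      · rintro ⟨⟨j, hj⟩, hv⟩
        exact ⟨j, hj, by rw [hv, hj]⟩
    · exact i.elim0
  | @func l f ts ih =>
    cases f with
    | zero =>
      refine (hdom.and (.of_qf ((var (Sum.inr ())).eq isTermFun_one))).congr fun v => ?_
      rw [← exists_and_right]
      refine exists_congr fun j => and_congr_right fun _ => ?_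
      exact Eq.congr rfl (pow_zero _)
    | one =>
      refine (hdom.and (.of_qf ((var (Sum.inr ())).eq isTermFun_omegaAddOne))).congr fun v => ?_
      rw [← exists_and_right]
      refine exists_congr fun j => and_congr_right fun _ => ?_
      exact Eq.congr rfl (pow_one _)
    | add =>
      let g (n : Fin 2) : Fin p ⊕ Unit → (Fin p ⊕ Unit) ⊕ Fin 2 :=
        Sum.elim (Sum.inl ∘ Sum.inl) fun _ => Sum.inr n
      have w (k : (Fin p ⊕ Unit) ⊕ Fin 2) := isTermFun_var (lam := lam) (h := h) k
      refine (EADefinable.exists' (δ := Fin 2) (((ih 0).comap (g 0)).and (((ih 1).comap (g 1)).and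
        (.of_qf ((w (Sum.inl (Sum.inr ()))).eq ((w (Sum.inr 0)).mul (w (Sum.inr 1)))))))).congr
        fun v => ?_
      constructor
      · rintro ⟨j, hj, hv⟩
        refine ⟨![⟨_, hB _⟩, ⟨_, hB _⟩], ⟨j, hj, rfl⟩, ⟨j, hj, rfl⟩, ?_⟩
        exact hv.trans (pow_add _ _ _)
      · rintro ⟨u, ⟨j, hj, h0⟩, ⟨j', hj', h1⟩, hv⟩
        obtain rfl := uniq hj hj'
        refine ⟨j, hj, hv.trans ?_⟩
        exact (congrArg₂ (· * ·) h0 h1).trans (pow_add _ _ _).symm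
    | mul =>
      let g (n : Fin 2) : Fin p ⊕ Unit → (Fin p ⊕ Unit) ⊕ Fin 2 :=
        Sum.elim (Sum.inl ∘ Sum.inl) fun _ => Sum.inr n
      refine (EADefinable.exists' (δ := Fin 2) (((ih 0).comap (g 0)).and (((ih 1).comap (g 1)).and
        (eaDefinable_mul (Sum.inr 0) (Sum.inr 1) (Sum.inl (Sum.inr ())))))).congr fun v => ?_
      constructor
      · rintro ⟨j, hj, hv⟩
        exact ⟨![⟨_, hB _⟩, ⟨_, hB _⟩], ⟨j, hj, rfl⟩, ⟨j, hj, rfl⟩, _, _, rfl, rfl, hv⟩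
      · rintro ⟨u, ⟨j, hj, h0⟩, ⟨j', hj', h1⟩, k, l, hk, hl, hv⟩
        obtain rfl := uniq hj hj'
        refine ⟨j, hj, hv.trans ?_⟩
        have e0 := omega0_add_one_pow_inj (h0.symm.trans hk)
        have e1 := omega0_add_one_pow_inj (h1.symm.trans hl)
        rw [← e0, ← e1]
        rfl

end OmegaDomain

theorem mainTheorem2 (lam : Ordinal.{u}) (hlam : 0 < lam) (p : ℕ)
    (E : arithLang.Formula (Fin p)) (hE : E.IsAtomic) :
    FragmentDefinable (L := ordMulLang) (IsExistsForall 6) (eqRel lam hlam E) := by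
  cases hE with
  | rel R ts => exact R.elim
  | equal s t =>
    -- The common value of both sides is quantified existentially.
    obtain ⟨φ, hφ, h⟩ := ((OmegaDomain.eaDefinable_term (h := hlam) s).and
      (OmegaDomain.eaDefinable_term t)).exists'.exists_formula
    have hE (j : Fin p → ℕ) : FirstOrder.Language.Formula.Realize (s.bdEqual t) j ↔
        s.realize (Sum.elim j Fin.elim0) = t.realize (Sum.elim j Fin.elim0) := by
      rw [FirstOrder.Language.Formula.Realize, FirstOrder.Language.BoundedFormula.realize_bdEqual]
      exact iff_of_eq (congrArg (fun xs : Fin 0 → ℕ =>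
        s.realize (Sum.elim j xs) = t.realize (Sum.elim j xs)) (Subsingleton.elim _ _))
    refine ⟨φ, hφ, Set.ext fun a => ?_⟩
    rw [Set.mem_ofPred_eq, h]
    constructor
    · rintro ⟨j, hj, ha⟩
      refine ⟨fun _ => ⟨(Ordinal.omega0 + 1) ^ s.realize (Sum.elim j Fin.elim0), ?_⟩,
        ⟨j, ha, rfl⟩, ⟨j, ha, ?_⟩⟩
      · exact Ordinal.pow_lt_of_isPrincipal (Ordinal.isPrincipal_mul_omega0_opow_opow lam)
          (OmegaDomain.one_lt hlam) (OmegaDomain.add_one_lt (OmegaDomain.omega_lt hlam) hlam) _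
      · exact congrArg (fun n : ℕ => (Ordinal.omega0.{u} + 1) ^ n)
          ((hE j).1 hj)
    · rintro ⟨u, ⟨j, ha, hs⟩, ⟨j', ha', ht⟩⟩
      have hjj : j = j' := funext fun i =>
        Ordinal.omega0_add_one_pow_inj ((ha i).symm.trans (ha' i))
      subst hjj
      exact ⟨j, (hE j).2 (Ordinal.omega0_add_one_pow_inj (hs.symm.trans ht)), ha⟩
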